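/- Let $a,k$ be integers with $2\le k\le a$, and put $b=a+k-1$ and $\lambda=\left\lfloor\frac{a-2}{k-1}\right\rfloor$. Let $S(AP(a,1;k))=\langle a,a+1,\dots,a+k-1\rangle$ be the submonoid of $\mathbb Z_{\ge0}$ generated by $a,a+1,\dots,a+k-1$. For rational $\alpha,\beta\ge 1$ let $[\alpha,\beta]=\{x\in\mathbb Q:\alpha\le x\le\beta\}$ (empty if $\alpha>\beta$) and let $S([\alpha,\beta])=\langle[\alpha,\beta]\rangle\cap\mathbb Z_{\ge0}$, where $\langle[\alpha,\beta]\rangle$ is the additive submonoid of $\mathbb Q_{\ge0}$ generated by $[\alpha,\beta]$. Under the convention that a quotient of a positive number by $0$ is $\infty$, consider the following conditions on $\alpha,\beta$: 1. $a-\frac{1}{\lambda+1}<\alpha\le a$ and $b\le\beta<b+\frac1\lambda$; 2. $1+\frac{\lambda}{\lambda(b-1)+1}<\alpha\le 1+\frac{1}{b-1}$ and $1+\frac{1}{a-1}\le\beta<1+\frac{\lambda+1}{(\lambda+1)(a-1)-1}$; 3. $a-1<\alpha\le\frac b2$ and $b-1\le\beta$; 4. $1<\alpha\le1+\frac1{b-2}$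 and $1+\frac{2}{b-2}\le\beta<1+\frac{1}{a-2}$. Let $\alpha,\beta\in\mathbb Q\cap[1,\infty)$. If $k<a$, then $S([\alpha,\beta])=S(AP(a,1;k))$ if and only if condition 1 or condition 2 holds. If $k=a$ (in which case $S(AP(a,1;k))=\{0,a,a+1,a+2,\dots\}$), then $S([\alpha,\beta])=S(AP(a,1;k))$ if and only if at least one of the conditions 1, 2, 3, 4 holds. -/

import Mathlib

/-- `S(A) = ⟨A⟩ ∩ ℤ_{≥0}`: the submonoid of the non-negative integers that lie in the additive
submonoid of the rationals generated by a set `A` (of non-negative rationals). -/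
def assocSemigroup (A : Set ℚ) : AddSubmonoid ℕ :=
  (AddSubmonoid.closure A).comap (Nat.castAddMonoidHom ℚ)

/-- `S(AP(a,d;k)) = ⟨a, a+d, …, a+(k-1)d⟩`, as a submonoid of the non-negative integers. -/
def apSemigroup (a d k : ℕ) : AddSubmonoid ℕ :=
  AddSubmonoid.closure {n : ℕ | ∃ i : ℕ, i < k ∧ n = a + i * d}

/-- The quotient `x / y` with the convention `x / 0 = ∞` (used only for `x > 0` and `y ≥ 0`). -/
def divTop (x y : ℚ) : WithTop ℚ :=
  if y = 0 then ⊤ else ((x / y : ℚ) : WithTop ℚ)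

/-! Both semigroups consist of the integers lying in dilates of an interval, `[α, β]` or `[a, b]`,
so the question is when two intervals give the same cone. A dilate of `[α, β]` of index `m` contains
`n` exactly when the dilate of index `n - m` of the image of `[α, β]` under `x ↦ x / (x - 1)` does.
Hence solutions come in dual pairs: conditions 2 and 4 are the duals of 1 and 3. The smallest
positive elements `a`, `a + 1` force one member of the pair to contain both (`interval_or_dual`).
That member then reaches up to `b`, except in one half-line case (`slightlyLarger_or_halfLine`), and
the last gap of the semigroup bounds its excess over `[a, b]`. -/

/-! ### Semigroups as integers in dilates of intervals -/

/-- `n` lies in one of the dilates `[m α, m β]`, `m ∈ ℕ`. -/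
def InCone (α β : ℚ) (n : ℕ) : Prop :=
  ∃ m : ℕ, (m : ℚ) * α ≤ n ∧ (n : ℚ) ≤ m * β

theorem mem_assocSemigroup_Icc (α β : ℚ) (n : ℕ) :
    n ∈ assocSemigroup (Set.Icc α β) ↔ InCone α β n := by
  have key : ∀ x : ℚ, x ∈ AddSubmonoid.closure (Set.Icc α β) →
      ∃ m : ℕ, (m : ℚ) * α ≤ x ∧ x ≤ m * β := by
    intro x hx
    induction hx using AddSubmonoid.closure_induction with
    | mem x hx => exact ⟨1, by simpa using hx.1, by simpa using hx.2⟩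
    | zero => exact ⟨0, by simp, by simp⟩
    | add x y _ _ hx hy =>
      obtain ⟨m, h1, h2⟩ := hx
      obtain ⟨l, h3, h4⟩ := hy
      exact ⟨m + l, by push_cast; linarith, by push_cast; linarith⟩
  constructor
  · exact fun h => key n h
  · rintro ⟨m, h1, h2⟩
    change (n : ℚ) ∈ AddSubmonoid.closure (Set.Icc α β)
    rcases Nat.eq_zero_or_pos m with rfl | hm
    · have : (n : ℚ) = 0 := le_antisymm (by simpa using h2) (by positivity)
      rw [this]
      exact zero_mem _
    · have hm' : (0 : ℚ) < m := by exact_mod_cast hm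
      have h : (n : ℚ) = m • ((n : ℚ) / m) := by
        rw [nsmul_eq_mul]
        field_simp
      have hx : (n : ℚ) / m ∈ Set.Icc α β := by
        rw [Set.mem_Icc, le_div_iff₀ hm', div_le_iff₀ hm']
        exact ⟨by linarith, by linarith⟩
      rw [h]
      exact nsmul_mem (AddSubmonoid.subset_closure hx) m

theorem mem_apSemigroup_one {a k b : ℕ} (hk : 1 ≤ k) (hb : b = a + k - 1) (n : ℕ) :
    n ∈ apSemigroup a 1 k ↔ ∃ m : ℕ, m * a ≤ n ∧ n ≤ m * b := by
  have gen : ∀ x, a ≤ x → x ≤ b → x ∈ apSemigroup a 1 k := fun x h1 h2 =>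
    AddSubmonoid.subset_closure ⟨x - a, by omega, by omega⟩
  constructor
  · intro hx
    induction hx using AddSubmonoid.closure_induction with
    | mem x hx =>
      obtain ⟨i, hi, rfl⟩ := hx
      exact ⟨1, by omega, by omega⟩
    | zero => exact ⟨0, by simp, by simp⟩
    | add x y _ _ hx hy =>
      obtain ⟨m, h1, h2⟩ := hx
      obtain ⟨l, h3, h4⟩ := hy
      exact ⟨m + l, by rw [add_mul]; omega, by rw [add_mul]; omega⟩
  · rintro ⟨m, h1, h2⟩
    induction m generalizing n with
    | zero =>
      obtain rfl : n = 0 := by simpa using h2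
      exact zero_mem _
    | succ m ih =>
      rw [add_mul, one_mul] at h1 h2
      have hab : m * a ≤ m * b := Nat.mul_le_mul_left m (by omega)
      rcases le_or_gt (m * a + b) n with h | h
      · rw [show n = (n - b) + b by omega]
        exact add_mem (ih _ (by omega) (by omega)) (gen b (by omega) le_rfl)
      · rw [show n = m * a + (n - m * a) by omega]
        exact add_mem (ih _ le_rfl hab) (gen _ (by omega) (by omega))

theorem mem_apSemigroup_one_iff_inCone {a k b : ℕ} (hk : 1 ≤ k) (hb : b = a + k - 1) (n : ℕ) :
    n ∈ apSemigroup a 1 k ↔ InCone a b n := by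
  rw [mem_apSemigroup_one hk hb]
  exact exists_congr fun m => by norm_cast

theorem assocSemigroup_eq_apSemigroup_iff {a k b : ℕ} (hk : 1 ≤ k) (hb : b = a + k - 1)
    (α β : ℚ) : assocSemigroup (Set.Icc α β) = apSemigroup a 1 k ↔
      ∀ n, InCone α β n ↔ InCone a b n := by
  rw [SetLike.ext_iff]
  simp only [mem_assocSemigroup_Icc, mem_apSemigroup_one_iff_inCone hk hb]

/-! ### Duality -/

/-- The involution `x ↦ x / (x - 1)` reverses the order on `(1, ∞)` and preserves cones. -/
theorem InCone.dual {α β : ℚ} (hα : 1 < α) (hβ : 1 < β) {n : ℕ} (h : InCone α β n) :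
    InCone (β / (β - 1)) (α / (α - 1)) n := by
  obtain ⟨m, h1, h2⟩ := h
  have hmn : m ≤ n := by
    have : (m : ℚ) ≤ n := by nlinarith [(Nat.cast_nonneg m : (0 : ℚ) ≤ m)]
    exact_mod_cast this
  -- If `n = m * x`, then `n - m = m * (x - 1)`, so `n = (n - m) * (x / (x - 1))`.
  refine ⟨n - m, ?_, ?_⟩
  · rw [Nat.cast_sub hmn, ← mul_div_assoc, div_le_iff₀ (by linarith)]
    linarith
  · rw [Nat.cast_sub hmn, ← mul_div_assoc, le_div_iff₀ (by linarith)]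
    linarith

theorem one_lt_div_sub_one {x : ℚ} (hx : 1 < x) : 1 < x / (x - 1) := by
  rw [lt_div_iff₀ (by linarith)]
  linarith

theorem div_sub_one_involutive {x : ℚ} (hx : 1 < x) :
    x / (x - 1) / (x / (x - 1) - 1) = x := by
  have : x - 1 ≠ 0 := by linarith
  have h : x / (x - 1) - 1 = 1 / (x - 1) := by
    field_simp
    ring
  rw [h]
  field_simp

theorem inCone_dual_iff {α β : ℚ} (hα : 1 < α) (hβ : 1 < β) (n : ℕ) :
    InCone (β / (β - 1)) (α / (α - 1)) n ↔ InCone α β n := by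
  refine ⟨fun h => ?_, fun h => h.dual hα hβ⟩
  have := h.dual (one_lt_div_sub_one hβ) (one_lt_div_sub_one hα)
  rwa [div_sub_one_involutive hα, div_sub_one_involutive hβ] at this

/-! ### Sufficiency of conditions 1 and 3 -/

/-- The interval `[α, β]` contains `[a, b]` and is only slightly larger: condition 1 with
denominators cleared. -/
def SlightlyLarger (a b lam : ℕ) (α β : ℚ) : Prop :=
  ((lam : ℚ) + 1) * a - 1 < (lam + 1) * α ∧ α ≤ a ∧ (b : ℚ) ≤ β ∧ (lam : ℚ) * β < lam * b + 1

/-- Condition 3, which describes the additional intervals for a half-line semigroup. -/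
def HalfLine (a b : ℕ) (α β : ℚ) : Prop :=
  (a : ℚ) - 1 < α ∧ α ≤ (b : ℚ) / 2 ∧ (b : ℚ) - 1 ≤ β

/-- The gaps of `⟨a, …, b⟩`: an element outside it lies between consecutive dilates of `[a, b]`,
and the left one has index at most `lam`. -/
theorem exists_gap {a k b lam : ℕ} (hk : 2 ≤ k) (hka : k ≤ a) (hb : b = a + k - 1)
    (hlam : lam = (a - 2) / (k - 1)) {n : ℕ} (hn : ¬ InCone a b n) :
    ∃ j : ℕ, j ≤ lam ∧ j * b < n ∧ n < (j + 1) * a := by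
  have hdiv := Nat.div_add_mod n a
  have hmod := Nat.mod_lt n (show 0 < a by omega)
  set j := n / a with hj
  rw [mul_comm] at hdiv
  have h2 : n < (j + 1) * a := by
    rw [add_mul, one_mul]
    omega
  have h1 : j * b < n := by
    by_contra! h
    exact hn ⟨j, by exact_mod_cast (by omega : j * a ≤ n), by exact_mod_cast h⟩
  refine ⟨j, ?_, h1, h2⟩
  rw [hlam, Nat.le_div_iff_mul_le (by omega)]
  obtain ⟨c, rfl⟩ : ∃ c, k = c + 1 := ⟨k - 1, by omega⟩
  have : b = a + c := by omega
  subst this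
  rw [mul_add] at h1
  rw [add_mul, one_mul] at h2
  simp only [Nat.add_sub_cancel]
  omega

/-- Over the indices that border a gap, the excess of `m * β` over `m * b`, and of `m * a` over `m *
α`, stays below 1, so no gap is filled. -/
theorem inCone_iff_of_slightlyLarger {a k b lam : ℕ} (hk : 2 ≤ k) (hka : k ≤ a)
    (hb : b = a + k - 1) (hlam : lam = (a - 2) / (k - 1)) {α β : ℚ} (hα : 1 ≤ α)
    (h : SlightlyLarger a b lam α β) (n : ℕ) : InCone α β n ↔ InCone a b n := by
  obtain ⟨h1, h2, h3, h4⟩ := h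
  constructor
  · rintro ⟨m, hm1, hm2⟩
    by_contra hn
    obtain ⟨j, hj, hj1, hj2⟩ := exists_gap hk hka hb hlam hn
    have hj' : (j : ℚ) ≤ lam := by exact_mod_cast hj
    have hj0 : (0 : ℚ) ≤ j := Nat.cast_nonneg j
    rcases le_or_gt m j with hmj | hmj
    · have hmj' : (m : ℚ) ≤ j := by exact_mod_cast hmj
      have hj1' : (j : ℚ) * b + 1 ≤ n := by exact_mod_cast hj1
      have hm0 : (0 : ℚ) ≤ m := Nat.cast_nonneg m
      have hb0 : (0 : ℚ) ≤ b := Nat.cast_nonneg b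
      have e1 : (m : ℚ) * (β - b) ≤ lam * (β - b) :=
        mul_le_mul_of_nonneg_right (hmj'.trans hj') (by linarith)
      have e2 : (m : ℚ) * b ≤ j * b := mul_le_mul_of_nonneg_right hmj' hb0
      linarith
    · have hmj' : (j : ℚ) + 1 ≤ m := by exact_mod_cast hmj
      have hj2' : (n : ℚ) + 1 ≤ (j + 1) * a := by exact_mod_cast hj2
      have e1 : ((j : ℚ) + 1) * (a - α) ≤ (lam + 1) * (a - α) :=
        mul_le_mul_of_nonneg_right (by linarith) (by linarith)
      have e2 : ((j : ℚ) + 1) * α ≤ m * α := mul_le_mul_of_nonneg_right hmj' (by linarith)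
      linarith
  · rintro ⟨m, hm1, hm2⟩
    have hm0 : (0 : ℚ) ≤ m := Nat.cast_nonneg m
    exact ⟨m, (mul_le_mul_of_nonneg_left h2 hm0).trans hm1,
      hm2.trans (mul_le_mul_of_nonneg_left h3 hm0)⟩

theorem inCone_iff_of_halfLine {a b : ℕ} (ha : 2 ≤ a) (hb : b = a + a - 1) {α β : ℚ}
    (h : HalfLine a b α β) (n : ℕ) : InCone α β n ↔ InCone a b n := by
  obtain ⟨h1, h2, h3⟩ := h
  have ha' : (2 : ℚ) ≤ a := by exact_mod_cast ha
  have hb' : (b : ℚ) = 2 * a - 1 := by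
    have : b + 1 = 2 * a := by omega
    have : (b : ℚ) + 1 = 2 * a := by exact_mod_cast this
    linarith
  have low : ∀ {γ δ : ℚ}, (a : ℚ) - 1 < γ → InCone γ δ n → n = 0 ∨ a ≤ n := by
    rintro γ δ hγ ⟨m, hm1, hm2⟩
    rcases Nat.eq_zero_or_pos m with rfl | hm
    · left
      have : (n : ℚ) ≤ 0 := by simpa using hm2
      have : n ≤ 0 := by exact_mod_cast this
      omega
    · right
      have hm' : (1 : ℚ) ≤ m := by exact_mod_cast hm
      have : (a : ℚ) < n + 1 := by nlinarith
      have : a < n + 1 := by exact_mod_cast this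
      omega
  have cover : n = 0 ∨ a ≤ n → InCone α β n := by
    rintro (rfl | hn)
    · exact ⟨0, by simp, by simp⟩
    · rcases lt_or_ge n b with hnb | hnb
      · have e1 : (a : ℚ) ≤ n := by exact_mod_cast hn
        have e2 : (n : ℚ) + 1 ≤ b := by exact_mod_cast hnb
        exact ⟨1, by push_cast; linarith, by push_cast; linarith⟩
      -- The largest `m` with `m * (b / 2) ≤ n` works: since `m ≥ 2` and `b ≥ 3`, also `n ≤ m * (b -
      -- 1)`.
      · have hdiv := Nat.div_add_mod (2 * n) b
        have hmod := Nat.mod_lt (2 * n) (show 0 < b by omega)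
        have hm2 : 2 ≤ 2 * n / b := by
          rw [Nat.le_div_iff_mul_le (by omega)]
          omega
        set m := 2 * n / b
        have e0 : (2 : ℚ) ≤ m := by exact_mod_cast hm2
        have e1 : (b : ℚ) * m ≤ 2 * n := by exact_mod_cast (by omega : b * m ≤ 2 * n)
        have e2 : 2 * (n : ℚ) + 1 ≤ b * m + b := by
          exact_mod_cast (by omega : 2 * n + 1 ≤ b * m + b)
        refine ⟨m, by nlinarith, ?_⟩
        have : (m : ℚ) * (b - 1) ≤ m * β := mul_le_mul_of_nonneg_left h3 (by linarith)
        nlinarith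
  have cover' : n = 0 ∨ a ≤ n → InCone a b n := by
    rintro (rfl | hn)
    · exact ⟨0, by simp, by simp⟩
    · have hdiv := Nat.div_add_mod n a
      have hmod := Nat.mod_lt n (show 0 < a by omega)
      have hm1 : 1 ≤ n / a := by rwa [Nat.le_div_iff_mul_le (by omega), one_mul]
      set m := n / a
      have e0 : (1 : ℚ) ≤ m := by exact_mod_cast hm1
      have e1 : (a : ℚ) * m ≤ n := by exact_mod_cast (by omega : a * m ≤ n)
      have e2 : (n : ℚ) + 1 ≤ a * m + a := by exact_mod_cast (by omega : n + 1 ≤ a * m + a)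
      exact ⟨m, by linarith, by rw [hb']; nlinarith⟩
  constructor
  · exact fun h => cover' (low h1 h)
  · exact fun h => cover (low (by linarith) h)

/-! ### Necessity -/

/-- The choice of `lam` leaves an integer strictly between `lam * b` and `(lam + 1) * a`. The two
ends of this gap, `(lam + 1) * a - 1` and `lam * b + 1`, give the bounds on `α` and `β`. -/
theorem slightlyLarger_of_inCone_iff {a k b lam : ℕ} (hk : 2 ≤ k) (hka : k ≤ a)
    (hb : b = a + k - 1) (hlam : lam = (a - 2) / (k - 1)) {α β : ℚ}
    (h : ∀ n, InCone α β n ↔ InCone a b n) (hα : α ≤ a) (hβ : (b : ℚ) ≤ β) :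
    SlightlyLarger a b lam α β := by
  have hlk : lam * (k - 1) + 2 ≤ a := by
    have := Nat.div_mul_le_self (a - 2) (k - 1)
    rw [← hlam] at this
    omega
  obtain ⟨c, rfl⟩ : ∃ c, k = c + 1 := ⟨k - 1, by omega⟩
  obtain rfl : b = a + c := by omega
  simp only [Nat.add_sub_cancel] at hlk
  have gap : ∀ n : ℕ, lam * (a + c) < n → n < (lam + 1) * a → ¬ InCone a (a + c : ℕ) n := by
    rintro n h1 h2 ⟨m, h3, h4⟩
    have h3 : m * a ≤ n := by exact_mod_cast h3
    have h4 : n ≤ m * (a + c) := by exact_mod_cast h4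
    have h5 : lam < m := lt_of_mul_lt_mul_right (h1.trans_le h4) (by omega)
    have h6 : m < lam + 1 := lt_of_mul_lt_mul_right (h3.trans_lt h2) (by omega)
    omega
  have expand : lam * (a + c) + 2 ≤ (lam + 1) * a := by
    rw [mul_add, add_mul, one_mul]
    omega
  have expand' : (lam : ℚ) * (a + c : ℕ) + 2 ≤ (lam + 1) * a := by exact_mod_cast expand
  have hl0 : (0 : ℚ) ≤ lam := Nat.cast_nonneg lam
  refine ⟨?_, hα, hβ, ?_⟩
  · by_contra! hc
    refine gap ((lam + 1) * a - 1) (by omega) (by omega) ((h _).1 ⟨lam + 1, ?_, ?_⟩)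
    · rw [Nat.cast_sub (by omega)]
      push_cast
      linarith
    · rw [Nat.cast_sub (by omega)]
      have : ((lam : ℚ) + 1) * a ≤ (lam + 1) * β := by
        refine mul_le_mul_of_nonneg_left (le_trans ?_ hβ) (by linarith)
        exact_mod_cast Nat.le_add_right a c
      push_cast
      linarith
  · by_contra! hc
    refine gap (lam * (a + c) + 1) (by omega) (by omega) ((h _).1 ⟨lam, ?_, ?_⟩)
    · have : (lam : ℚ) * α ≤ lam * (a + c : ℕ) := by
        refine mul_le_mul_of_nonneg_left (hα.trans ?_) hl0
        exact_mod_cast Nat.le_add_right a c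
      push_cast at this ⊢
      linarith
    · push_cast at hc ⊢
      linarith

/-- If `[α, β]` contains `a` and `a + 1`, then it contains `[a, b]`, unless the semigroup is a
half-line. -/
theorem slightlyLarger_or_halfLine {a k b lam : ℕ} (hk : 2 ≤ k) (hka : k ≤ a)
    (hb : b = a + k - 1) (hlam : lam = (a - 2) / (k - 1)) {α β : ℚ}
    (h : ∀ n, InCone α β n ↔ InCone a b n) (hα : α ≤ a) (hβ : (a : ℚ) + 1 ≤ β) :
    SlightlyLarger a b lam α β ∨ (k = a ∧ HalfLine a b α β) := by
  have hα1 : (a : ℚ) - 1 < α := by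
    by_contra! hc
    obtain ⟨m, h1, h2⟩ := (h (a - 1)).1
      ⟨1, by rw [Nat.cast_sub (by omega)]; push_cast; linarith,
        by rw [Nat.cast_sub (by omega)]; push_cast; linarith⟩
    have h1 : m * a ≤ a - 1 := by exact_mod_cast h1
    have h2 : a - 1 ≤ m * b := by exact_mod_cast h2
    rcases Nat.eq_zero_or_pos m with rfl | hm
    · omega
    · nlinarith [Nat.le_mul_of_pos_left a hm, Nat.sub_lt (show 0 < a by omega) one_pos]
  by_cases hhalf : k = a ∧ HalfLine a b α β
  · exact Or.inr hhalf
  left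
  have climb : ∀ i : ℕ, i + 2 ≤ k → ((a + i + 1 : ℕ) : ℚ) ≤ β := by
    intro i
    induction i with
    | zero => intro _; push_cast; linarith
    | succ i ih =>
      intro hi
      have hi' := ih (by omega)
      obtain ⟨m, h1, h2⟩ := (h (a + (i + 1) + 1)).2
        ⟨1, by exact_mod_cast (by omega : 1 * a ≤ a + (i + 1) + 1),
          by exact_mod_cast (by omega : a + (i + 1) + 1 ≤ 1 * b)⟩
      by_contra! hc
      -- An element beyond `β` needs an index of at least 2; with `a - 1 < α` this is possible only
      -- for `k = a` and the element `b`.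
      have hm : 2 ≤ m := by
        by_contra! hm
        interval_cases m
        · have : ((a + (i + 1) + 1 : ℕ) : ℚ) ≤ 0 := by simpa using h2
          have : a + (i + 1) + 1 ≤ 0 := by exact_mod_cast this
          omega
        · push_cast at h2 hc
          linarith
      have hm' : (2 : ℚ) ≤ m := by exact_mod_cast hm
      have ha0 : (2 : ℚ) ≤ a := by exact_mod_cast hk.trans hka
      have h3 : 2 * α ≤ ((a + (i + 1) + 1 : ℕ) : ℚ) :=
        (mul_le_mul_of_nonneg_right hm' (by linarith)).trans h1
      have h4 : 2 * a < a + (i + 1) + 1 + 2 := by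
        have : 2 * (a : ℚ) < ((a + (i + 1) + 1 : ℕ) : ℚ) + 2 := by linarith
        exact_mod_cast this
      have hka' : k = a := by omega
      have hbi : b = a + (i + 1) + 1 := by omega
      refine hhalf ⟨hka', hα1, ?_, ?_⟩
      · rw [hbi]
        linarith
      · rw [hbi]
        push_cast at hi' ⊢
        linarith
  have hbβ := climb (k - 2) (by omega)
  rw [show a + (k - 2) + 1 = b by omega] at hbβ
  exact slightlyLarger_of_inCone_iff hk hka hb hlam h hα hbβ

/-- If `a` and `a + 1` lie in the same dilate of `[α, β]` while `1, …, a - 1` lie in none, then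
`a` and `a + 1` lie in `[α, β]`. -/
theorem index_eq_one {a m : ℕ} {α β : ℚ} (hα : 1 < α)
    (hgap : ∀ n, 0 < n → n < a → ¬ InCone α β n) (ha : 0 < a)
    (h1 : (m : ℚ) * α ≤ a) (h2 : (a : ℚ) + 1 ≤ m * β) : m = 1 := by
  rcases Nat.eq_zero_or_pos m with rfl | hm
  · have : (0 : ℚ) ≤ a := Nat.cast_nonneg a
    simp at h2
    linarith
  by_contra hm1
  have hm2 : 2 ≤ m := by omega
  have hma : m ≤ a := by
    have hm0 : (0 : ℚ) ≤ m := Nat.cast_nonneg m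
    have : (m : ℚ) ≤ a := by nlinarith
    exact_mod_cast this
  have hdiv := Nat.div_add_mod a m
  have hmod := Nat.mod_lt a hm
  have hq : 1 ≤ a / m := by rwa [Nat.le_div_iff_mul_le hm, one_mul]
  have hqa : a / m < a := Nat.div_lt_self ha (by omega)
  set q := a / m
  set r := a % m
  -- `a - q` is `(m - 1) * a / m` rounded up; since `r ≤ m - 1`, it is at most `(m - 1) * (a + 1) /
  -- m`.
  refine hgap (a - q) (by omega) (by omega) ⟨m - 1, ?_, ?_⟩
  all_goals
    rw [Nat.cast_sub hm, Nat.cast_sub hqa.le]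
    have hm' : (2 : ℚ) ≤ m := by exact_mod_cast hm2
    have hr0 : (0 : ℚ) ≤ r := Nat.cast_nonneg r
    have hr : (r : ℚ) + 1 ≤ m := by exact_mod_cast hmod
    have hd : (m : ℚ) * q + r = a := by exact_mod_cast hdiv
    push_cast
  · have e1 : ((m : ℚ) - 1) * (m * α) ≤ (m - 1) * a :=
      mul_le_mul_of_nonneg_left h1 (by linarith)
    have e2 : (m : ℚ) * ((m - 1) * α) ≤ m * (a - q) := by linarith
    exact le_of_mul_le_mul_left e2 (by linarith)
  · have e1 : ((m : ℚ) - 1) * (a + 1) ≤ (m - 1) * (m * β) :=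
      mul_le_mul_of_nonneg_left h2 (by linarith)
    have e2 : (m : ℚ) * (a - q) ≤ m * ((m - 1) * β) := by linarith
    exact le_of_mul_le_mul_left e2 (by linarith)

/-- Consecutive minimal elements `a`, `a + 1` of a cone lie in the interval or in its dual. -/
theorem interval_or_dual {a : ℕ} {α β : ℚ} (ha : 2 ≤ a) (hα : 1 < α) (hβ : 1 < β)
    (hgap : ∀ n, 0 < n → n < a → ¬ InCone α β n) (h0 : InCone α β a)
    (h1 : InCone α β (a + 1)) :
    (α ≤ a ∧ (a : ℚ) + 1 ≤ β) ∨
      (β / (β - 1) ≤ a ∧ (a : ℚ) + 1 ≤ α / (α - 1)) := by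
  obtain ⟨m, hm1, hm2⟩ := h0
  obtain ⟨l, hl1, hl2⟩ := h1
  push_cast at hl1 hl2
  have below : ∀ j : ℕ, (j : ℚ) * α ≤ (a : ℚ) - 1 → (a : ℚ) - 1 ≤ j * β → False := by
    intro j h1 h2
    refine hgap (a - 1) (by omega) (by omega) ⟨j, ?_, ?_⟩
    all_goals
      rw [Nat.cast_sub (by omega)]
      push_cast
      assumption
  have hm0 : (0 : ℚ) ≤ m := Nat.cast_nonneg m
  rcases le_or_gt l m with hlm | hlm
  · left
    have hlm' : (l : ℚ) ≤ m := by exact_mod_cast hlm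
    have h2 : (a : ℚ) + 1 ≤ m * β :=
      hl2.trans (mul_le_mul_of_nonneg_right hlm' (by linarith))
    obtain rfl := index_eq_one hα hgap (by omega) hm1 h2
    exact ⟨by simpa using hm1, by simpa using h2⟩
  · right
    have hlm' : (m : ℚ) + 1 ≤ l := by exact_mod_cast hlm
    have h2 : ((m : ℚ) + 1) * α ≤ a + 1 :=
      (mul_le_mul_of_nonneg_right hlm' (by linarith)).trans hl1
    have hma : m ≤ a := by
      have : (m : ℚ) ≤ a := by nlinarith
      exact_mod_cast this
    -- In the dual, `a` has index `a - m` and `a + 1` has index `a + 1 - l ≤ a - m`, so the previous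
    -- case applies there.
    have e1 : ((a - m : ℕ) : ℚ) * (β / (β - 1)) ≤ a := by
      rw [Nat.cast_sub hma, ← mul_div_assoc, div_le_iff₀ (by linarith)]
      linarith
    have e2 : (a : ℚ) + 1 ≤ (a - m : ℕ) * (α / (α - 1)) := by
      rw [Nat.cast_sub hma, ← mul_div_assoc, le_div_iff₀ (by linarith)]
      linarith
    have hone := index_eq_one (one_lt_div_sub_one hβ)
      (fun n hn hna => by rw [inCone_dual_iff hα hβ]; exact hgap n hn hna) (by omega) e1 e2
    rw [hone] at e1 e2
    exact ⟨by simpa using e1, by simpa using e2⟩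

theorem inCone_iff_classification {a k b lam : ℕ} (hk : 2 ≤ k) (hka : k ≤ a)
    (hb : b = a + k - 1) (hlam : lam = (a - 2) / (k - 1)) {α β : ℚ} (hα : 1 < α) (hβ : 1 < β) :
    (∀ n, InCone α β n ↔ InCone a b n) ↔
      (SlightlyLarger a b lam α β ∨ (k = a ∧ HalfLine a b α β)) ∨
      (SlightlyLarger a b lam (β / (β - 1)) (α / (α - 1)) ∨
        (k = a ∧ HalfLine a b (β / (β - 1)) (α / (α - 1)))) := by
  have hgen : ∀ {α β : ℚ}, 1 < α → SlightlyLarger a b lam α β ∨ (k = a ∧ HalfLine a b α β) →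
      ∀ n, InCone α β n ↔ InCone a b n := by
    rintro α β hα (h | ⟨rfl, h⟩)
    · exact inCone_iff_of_slightlyLarger hk hka hb hlam hα.le h
    · exact inCone_iff_of_halfLine hk hb h
  constructor
  · intro h
    have hgap : ∀ n, 0 < n → n < a → ¬ InCone α β n := by
      intro n h1 h2 hn
      obtain ⟨m, h3, h4⟩ := (h n).1 hn
      have h3 : m * a ≤ n := by exact_mod_cast h3
      have h4 : n ≤ m * b := by exact_mod_cast h4
      rcases Nat.eq_zero_or_pos m with rfl | hm
      · omega
      · have := Nat.le_mul_of_pos_left a hm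
        omega
    have hdil : ∀ n : ℕ, a ≤ n → n ≤ b → InCone α β n := fun n h1 h2 =>
      (h n).2 ⟨1, by simpa using h1, by simpa using h2⟩
    rcases interval_or_dual (hk.trans hka) hα hβ hgap (hdil a le_rfl (by omega))
      (hdil (a + 1) (by omega) (by omega)) with ⟨h1, h2⟩ | ⟨h1, h2⟩
    · exact Or.inl (slightlyLarger_or_halfLine hk hka hb hlam h h1 h2)
    · exact Or.inr (slightlyLarger_or_halfLine hk hka hb hlam
        (fun n => (inCone_dual_iff hα hβ n).trans (h n)) h1 h2)
  · rintro (h | h) n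
    · exact hgen hα h n
    · exact (inCone_dual_iff hα hβ n).symm.trans (hgen (one_lt_div_sub_one hβ) h n)

/-! ### Clearing denominators in the four conditions -/

theorem lt_coe_add_divTop_iff {x c p q : ℚ} (hq : 0 ≤ q) (hp : 0 < p) :
    (x : WithTop ℚ) < (c : WithTop ℚ) + divTop p q ↔ (x - c) * q < p := by
  unfold divTop
  split_ifs with h
  · simp [h, hp]
  · have hq' : 0 < q := lt_of_le_of_ne hq (Ne.symm h)
    rw [← WithTop.coe_add, WithTop.coe_lt_coe, ← sub_lt_iff_lt_add', lt_div_iff₀ hq']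

theorem condition_one_iff {a b lam : ℕ} {α β : ℚ} :
    ((a : ℚ) - 1 / ((lam : ℚ) + 1) < α ∧ α ≤ (a : ℚ) ∧
      (b : ℚ) ≤ β ∧ (β : WithTop ℚ) < ((b : ℚ) : WithTop ℚ) + divTop 1 (lam : ℚ)) ↔
      SlightlyLarger a b lam α β := by
  have hl : (0 : ℚ) < lam + 1 := by positivity
  rw [lt_coe_add_divTop_iff (by positivity) one_pos, SlightlyLarger, sub_lt_comm,
    lt_div_iff₀ hl]
  refine and_congr ?_ (and_congr Iff.rfl (and_congr Iff.rfl ?_)) <;>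
    constructor <;> intro h <;> linarith

/-- The four inequalities correspond in reverse order, because the involution reverses order. -/
theorem condition_two_iff {a b lam : ℕ} (ha : 2 ≤ a) (hab : a < b) {α β : ℚ} (hα : 1 < α)
    (hβ : 1 < β) :
    (1 + (lam : ℚ) / ((lam : ℚ) * ((b : ℚ) - 1) + 1) < α ∧ α ≤ 1 + 1 / ((b : ℚ) - 1) ∧
      1 + 1 / ((a : ℚ) - 1) ≤ β ∧
      (β : WithTop ℚ) < 1 + divTop ((lam : ℚ) + 1) (((lam : ℚ) + 1) * ((a : ℚ) - 1) - 1)) ↔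
      SlightlyLarger a b lam (β / (β - 1)) (α / (α - 1)) := by
  have hl0 : (0 : ℚ) ≤ lam := Nat.cast_nonneg lam
  have ha' : (2 : ℚ) ≤ a := by exact_mod_cast ha
  have hb' : (2 : ℚ) < b := by exact_mod_cast (ha.trans_lt hab)
  have hα' : 0 < α - 1 := by linarith
  have hβ' : 0 < β - 1 := by linarith
  have hd : 0 < (lam : ℚ) * (b - 1) + 1 := by nlinarith
  rw [← WithTop.coe_one, lt_coe_add_divTop_iff (by nlinarith) (by linarith), SlightlyLarger,
    ← lt_sub_iff_add_lt', div_lt_iff₀ hd, ← sub_le_iff_le_add', le_div_iff₀ (by linarith),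
    ← le_sub_iff_add_le', div_le_iff₀ (by linarith), ← mul_div_assoc, lt_div_iff₀ hβ',
    div_le_iff₀ hβ', le_div_iff₀ hα', ← mul_div_assoc, div_lt_iff₀ hα']
  constructor <;> rintro ⟨h1, h2, h3, h4⟩ <;> refine ⟨?_, ?_, ?_, ?_⟩ <;> linarith

theorem condition_four_iff {a b : ℕ} (ha : 2 ≤ a) (hab : a < b) {α β : ℚ} (hα : 1 < α)
    (hβ : 1 < β) :
    (1 < α ∧ α ≤ 1 + 1 / ((b : ℚ) - 2) ∧ 1 + 2 / ((b : ℚ) - 2) ≤ β ∧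
      (β : WithTop ℚ) < 1 + divTop 1 ((a : ℚ) - 2)) ↔
      HalfLine a b (β / (β - 1)) (α / (α - 1)) := by
  have ha' : (2 : ℚ) ≤ a := by exact_mod_cast ha
  have hb' : (2 : ℚ) < b := by exact_mod_cast (ha.trans_lt hab)
  have hα' : 0 < α - 1 := by linarith
  have hβ' : 0 < β - 1 := by linarith
  rw [← WithTop.coe_one, lt_coe_add_divTop_iff (by linarith) one_pos, HalfLine,
    ← sub_le_iff_le_add', le_div_iff₀ (by linarith), ← le_sub_iff_add_le',
    div_le_iff₀ (by linarith), lt_div_iff₀ hβ', div_le_iff₀ hβ', le_div_iff₀ hα']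
  constructor
  · rintro ⟨-, h2, h3, h4⟩
    refine ⟨?_, ?_, ?_⟩ <;> linarith
  · rintro ⟨h1, h2, h3⟩
    refine ⟨hα, ?_, ?_, ?_⟩ <;> linarith

/-- A cone that avoids `1` but contains a positive integer has both ends larger than `1`. -/
theorem one_lt_of_inCone {α β : ℚ} (hα : 1 ≤ α) (hβ : 1 ≤ β) (h1 : ¬ InCone α β 1) {n : ℕ}
    (hn : 0 < n) (h : InCone α β n) : 1 < α ∧ 1 < β := by
  have hα1 : 1 < α := lt_of_le_of_ne hα fun he => h1 ⟨1, by simp [← he], by simpa using hβ⟩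
  obtain ⟨m, h2, h3⟩ := h
  refine ⟨hα1, ?_⟩
  have hn' : (0 : ℚ) < n := by exact_mod_cast hn
  have hm : (0 : ℚ) < m := by
    rcases Nat.eq_zero_or_pos m with rfl | hm
    · simp at h3
      omega
    · exact_mod_cast hm
  exact hα1.trans_le (le_of_mul_le_mul_left (h2.trans h3) hm)

theorem mainTheorem6 (a k b lam : ℕ) (hk : 2 ≤ k) (hka : k ≤ a)
    (hb : b = a + k - 1) (hlam : lam = (a - 2) / (k - 1))
    (α β : ℚ) (hα : 1 ≤ α) (hβ : 1 ≤ β) :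
    (k < a →
      (assocSemigroup (Set.Icc α β) = apSemigroup a 1 k ↔
        (((a : ℚ) - 1 / ((lam : ℚ) + 1) < α ∧ α ≤ (a : ℚ) ∧
            (b : ℚ) ≤ β ∧ (β : WithTop ℚ) < ((b : ℚ) : WithTop ℚ) + divTop 1 (lam : ℚ)) ∨
          (1 + (lam : ℚ) / ((lam : ℚ) * ((b : ℚ) - 1) + 1) < α ∧ α ≤ 1 + 1 / ((b : ℚ) - 1) ∧
            1 + 1 / ((a : ℚ) - 1) ≤ β ∧
            (β : WithTop ℚ) <
              1 + divTop ((lam : ℚ) + 1) (((lam : ℚ) + 1) * ((a : ℚ) - 1) - 1))))) ∧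
    (k = a →
      (assocSemigroup (Set.Icc α β) = apSemigroup a 1 k ↔
        (((a : ℚ) - 1 / ((lam : ℚ) + 1) < α ∧ α ≤ (a : ℚ) ∧
            (b : ℚ) ≤ β ∧ (β : WithTop ℚ) < ((b : ℚ) : WithTop ℚ) + divTop 1 (lam : ℚ)) ∨
          (1 + (lam : ℚ) / ((lam : ℚ) * ((b : ℚ) - 1) + 1) < α ∧ α ≤ 1 + 1 / ((b : ℚ) - 1) ∧
            1 + 1 / ((a : ℚ) - 1) ≤ β ∧
            (β : WithTop ℚ) <
              1 + divTop ((lam : ℚ) + 1) (((lam : ℚ) + 1) * ((a : ℚ) - 1) - 1)) ∨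
          ((a : ℚ) - 1 < α ∧ α ≤ (b : ℚ) / 2 ∧ (b : ℚ) - 1 ≤ β) ∨
          (1 < α ∧ α ≤ 1 + 1 / ((b : ℚ) - 2) ∧
            1 + 2 / ((b : ℚ) - 2) ≤ β ∧
            (β : WithTop ℚ) < 1 + divTop 1 ((a : ℚ) - 2))))) := by
  have hab : a < b := by omega
  have ha : 2 ≤ a := hk.trans hka
  have ha' : (2 : ℚ) ≤ a := by exact_mod_cast ha
  have hab' : (a : ℚ) + 1 ≤ b := by exact_mod_cast hab
  rw [assocSemigroup_eq_apSemigroup_iff (by omega) hb, condition_one_iff]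
  by_cases hone : 1 < α ∧ 1 < β
  · obtain ⟨hα1, hβ1⟩ := hone
    rw [condition_two_iff ha hab hα1 hβ1, condition_four_iff ha hab hα1 hβ1,
      inCone_iff_classification hk hka hb hlam hα1 hβ1]
    change _ ∧ (_ → (_ ↔ _ ∨ _ ∨ HalfLine a b α β ∨ _))
    constructor
    · intro hlt
      have := hlt.ne
      tauto
    · intro heq
      tauto
  -- With an endpoint equal to 1 there is no dual interval, but then both sides of the equivalence
  -- fail.
  · have hS : ¬ ∀ n, InCone α β n ↔ InCone a b n := by
      intro h
      refine hone (one_lt_of_inCone hα hβ (fun h1 => ?_) (show 0 < a by omega)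
        ((h a).2 ⟨1, by simp, by simpa using hab.le⟩))
      obtain ⟨m, h2, h3⟩ := (h 1).1 h1
      have h2 : m * a ≤ 1 := by exact_mod_cast h2
      have h3 : 1 ≤ m * b := by exact_mod_cast h3
      rcases Nat.eq_zero_or_pos m with rfl | hm
      · omega
      · have := Nat.le_mul_of_pos_left a hm
        omega
    have hl0 : (0 : ℚ) ≤ lam := Nat.cast_nonneg lam
    have c1 : ¬ SlightlyLarger a b lam α β := by
      rintro ⟨h1, h2, h3, -⟩
      exact hone ⟨by nlinarith, by linarith⟩
    have hd : 0 < (lam : ℚ) * (b - 1) + 1 := by nlinarith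
    have ha1 : 0 < 1 / ((a : ℚ) - 1) := one_div_pos.2 (by linarith)
    have hb2 : 0 < 2 / ((b : ℚ) - 2) := div_pos two_pos (by linarith)
    refine ⟨fun _ => iff_of_false hS ?_, fun _ => iff_of_false hS ?_⟩
    · rintro (h | ⟨h1, h2, h3, -⟩)
      · exact c1 h
      · exact hone ⟨by linarith [div_nonneg hl0 hd.le], by linarith⟩
    · rintro (h | ⟨h1, h2, h3, -⟩ | ⟨h1, h2, h3⟩ | ⟨h1, h2, h3, -⟩)
      · exact c1 h
      · exact hone ⟨by linarith [div_nonneg hl0 hd.le], by linarith⟩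
      · exact hone ⟨by linarith, by linarith⟩
      · exact hone ⟨h1, by linarith⟩
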